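/- Let $\mathcal X$ be a finite set and $\mathcal S(\mathcal X)$ the set of probability distributions on it. Let $R\subseteq\mathcal S(\mathcal X)$ be arbitrary, let $\sigma\in\mathcal S(\mathcal X)$, and consider the i.i.d. problem of testing the composite null hypothesis $R$ against the simple alternative $\sigma$: a test on $n$ samples is a function $T:\mathcal X^n\to[0,1]$, with $\varrho^{\otimes n}(T):=\sum_{\underline x\in\mathcal X^n}\varrho^{\otimes n}(\underline x)T(\underline x)$, type I error $\alpha_n(R|T):=\sup_{\varrho\in R}\varrho^{\otimes n}(1-T)$ and type II error $\beta_n(\sigma|T):=\sigma^{\otimes n}(T)$. For $r\in\mathbb R$ the strong converse exponent is $$\mathrm{sc}_r(R\|\sigma):=\inf\Big\{\limsup_{n\to\infty}-\tfrac1n\log\big(1-\alpha_n(R|T_n)\big):\ \liminf_{n\to\infty}-\tfrac1n\log\beta_n(\sigma|T_n)\ge r\Big\}\in[0,+\infty],$$ the infimum being over all sequences of tests $(T_n)_n$ satisfying the indicated condition ($-\log 0:=+\infty$), and $\mathrm{sc}_r(\varrho\|\sigma):=\mathrm{sc}_r(\{\varrho\}\|\sigma)$. For $\varrho\in\mathcal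 S(\mathcal X)$ with $\mathrm{supp}\,\varrho\subseteq\mathrm{supp}\,\sigma$ let $D(\varrho\|\sigma):=\sum_x\varrho(x)\log\frac{\varrho(x)}{\sigma(x)}$ and $\psi(\varrho\|\sigma|\alpha):=\log\sum_x\varrho(x)^\alpha\sigma(x)^{1-\alpha}$ for $\alpha\ge1$; if $\mathrm{supp}\,\varrho\not\subseteq\mathrm{supp}\,\sigma$, both are $+\infty$. Let $D_\infty^*(\varrho\|\sigma):=\inf\{\lambda\in\mathbb R:\varrho\le e^\lambda\sigma\}$, and let $\tilde\psi(\varrho\|\sigma|u):=(1-u)\,\psi(\varrho\|\sigma|\tfrac1{1-u})$ for $u\in(0,1)$, $\tilde\psi(\varrho\|\sigma|0):=0$, $\tilde\psi(\varrho\|\sigma|1):=D_\infty^*(\varrho\|\sigma)$. The Hoeffding anti-divergence is $H_r^*(\varrho\|\sigma):=\sup_{u\in[0,1]}[ur-\tilde\psi(\varrho\|\sigma|u)]$, and $H_r^*(R\|\sigma):=\sup_{\varrho\in R}H_r^*(\varrho\|\sigma)$, $D(R\|\sigma):=\inf_{\varrho\in R}D(\varrho\|\sigma)$. Finally $r_\infty(\varrho\|\sigma):=\sup_{\alpha\ge1}\{\alpha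 D_\infty^*(\varrho\|\sigma)-\psi(\varrho\|\sigma|\alpha)\}$ if $\mathrm{supp}\,\varrho\subseteq\mathrm{supp}\,\sigma$, and $r_\infty(\varrho\|\sigma):=+\infty$ otherwise. **Theorem.** Assume that $$\delta_{\min}(R):=\sup_{\varrho\in R}\Big(-\log\min_{x\in\mathrm{supp}\,\varrho}\varrho(x)\Big)<+\infty .$$ Then, for every real $r$ with $D(R\|\sigma)<r<\inf_{\varrho\in R}r_\infty(\varrho\|\sigma)$, $$\mathrm{sc}_r(R\|\sigma)=H_r^*(R\|\sigma)=\sup_{\varrho\in R}\mathrm{sc}_r(\varrho\|\sigma).$$ -/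

import Mathlib

noncomputable section

namespace HypothesisTesting

variable {X : Type*} [Fintype X]

/-! States on the finite set `X` are the elements of `stdSimplex ℝ X`; all logarithms are natural. -/

/-- The i.i.d. extension `ρ^{⊗n}`, as a function on sequences of length `n`. -/
def iidPow (ρ : X → ℝ) (n : ℕ) (x : Fin n → X) : ℝ := ∏ i, ρ (x i)

/-- A (randomized) test on `X^n`. `T x` is the probability of accepting the null hypothesis. -/
def IsTest {n : ℕ} (T : (Fin n → X) → ℝ) : Prop := ∀ x, 0 ≤ T x ∧ T x ≤ 1

/-- The probability `ρ^{⊗n}(T)` that the test `T` accepts the null hypothesis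
when the true state is `ρ^{⊗n}`. -/
def acceptProb (ρ : X → ℝ) {n : ℕ} (T : (Fin n → X) → ℝ) : ℝ := ∑ x, iidPow ρ n x * T x

/-- The worst-case type I error `α_n(R|T) = sup_{ρ ∈ R} ρ^{⊗n}(1 - T)`. -/
def typeIError (R : Set (X → ℝ)) {n : ℕ} (T : (Fin n → X) → ℝ) : ℝ :=
  sSup ((fun ρ => acceptProb ρ (fun x => 1 - T x)) '' R)

/-- The type II error `β_n(σ|T) = σ^{⊗n}(T)`. -/
def typeIIError (σ : X → ℝ) {n : ℕ} (T : (Fin n → X) → ℝ) : ℝ := acceptProb σ T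

/-- `-(1/n) log p`, with value `+∞` at `p = 0` (for `n ≥ 1`). -/
def expRate (n : ℕ) (p : ℝ) : EReal :=
  -(((1 / (n : ℝ) : ℝ) : EReal) * ENNReal.log (ENNReal.ofReal p))

/-- The strong converse exponent `sc_r(R‖σ)` of the i.i.d. problem with null hypothesis `R`
and simple alternative `σ`. -/
def strongConverseExp (R : Set (X → ℝ)) (σ : X → ℝ) (r : ℝ) : EReal :=
  sInf {e : EReal | ∃ T : (n : ℕ) → (Fin n → X) → ℝ,
    (∀ n, IsTest (T n)) ∧
    (r : EReal) ≤ Filter.liminf (fun n => expRate n (typeIIError σ (T n))) Filter.atTop ∧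
    e = Filter.limsup (fun n => expRate n (1 - typeIError R (T n))) Filter.atTop}

/-- `supp ρ ⊆ supp σ`. -/
def SuppLE (ρ σ : X → ℝ) : Prop := ∀ x, σ x = 0 → ρ x = 0

open Classical in
/-- The relative entropy `D(ρ‖σ)`. -/
def relEntropy (ρ σ : X → ℝ) : EReal :=
  if SuppLE ρ σ then ((∑ x, ρ x * Real.log (ρ x / σ x) : ℝ) : EReal) else ⊤

/-- `D(R‖σ) = inf_{ρ ∈ R} D(ρ‖σ)`. -/
def relEntropySet (R : Set (X → ℝ)) (σ : X → ℝ) : EReal := ⨅ ρ ∈ R, relEntropy ρ σ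

/-- The max-relative entropy `D_∞^*(ρ‖σ) = inf {λ ∈ ℝ : ρ ≤ e^λ σ}`. -/
def maxRelEntropy (ρ σ : X → ℝ) : EReal :=
  ⨅ l ∈ {l : ℝ | ∀ x, ρ x ≤ Real.exp l * σ x}, (l : EReal)

open Classical in
/-- `ψ^*(ρ‖σ|α) = log ∑ ρ^α σ^{1-α}` for `α ≥ 1`, equal to `+∞` unless `supp ρ ⊆ supp σ`. -/
def psi (ρ σ : X → ℝ) (α : ℝ) : EReal :=
  if SuppLE ρ σ then ((Real.log (∑ x, ρ x ^ α * σ x ^ (1 - α)) : ℝ) : EReal) else ⊤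

/-- `ψ̃^*(ρ‖σ|u) = (1-u) ψ^*(ρ‖σ|1/(1-u)) = u D^*_{1/(1-u)}(ρ‖σ)` for `u ∈ [0,1]`. The value at
`u = 1` is `D_∞^*(ρ‖σ)`; the value at `u = 0` is `0`, also when `ρ` is not supported in the support
of `σ`, by the convention `0 · (+∞) = 0`. -/
def psiTilde (ρ σ : X → ℝ) (u : ℝ) : EReal :=
  if u = 0 then 0
  else if u = 1 then maxRelEntropy ρ σ
  else ((1 - u : ℝ) : EReal) * psi ρ σ (1 - u)⁻¹

/-- The Hoeffding anti-divergence `H_r^*(ρ‖σ) = max_{u ∈ [0,1]} [u r - ψ̃^*(ρ‖σ|u)]`. -/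
def hoeffdingAnti (ρ σ : X → ℝ) (r : ℝ) : EReal :=
  ⨆ u ∈ Set.Icc (0 : ℝ) 1, (((u * r : ℝ) : EReal) - psiTilde ρ σ u)

/-- `H_r^*(R‖σ) = sup_{ρ ∈ R} H_r^*(ρ‖σ)`. -/
def hoeffdingAntiSet (R : Set (X → ℝ)) (σ : X → ℝ) (r : ℝ) : EReal :=
  ⨆ ρ ∈ R, hoeffdingAnti ρ σ r

/-- The Legendre-Fenchel transform `Ψ(c) = sup_{α ≥ 1} (c α - ψ^*(ρ‖σ|α))`. -/
def legendrePsi (ρ σ : X → ℝ) (c : EReal) : EReal :=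
  ⨆ α ∈ Set.Ici (1 : ℝ), (c * (α : EReal) - psi ρ σ α)

open Classical in
/-- `r_∞(ρ‖σ) = Ψ(D_∞^*(ρ‖σ))`, which is `+∞` if `ρ` is not supported in the support of `σ`
(then `D_∞^*(ρ‖σ) = +∞`). -/
def rInfty (ρ σ : X → ℝ) : EReal :=
  if SuppLE ρ σ then legendrePsi ρ σ (maxRelEntropy ρ σ) else ⊤

/-- `min_{x ∈ supp ρ} ρ(x)`. -/
def minNonzeroProb (ρ : X → ℝ) : ℝ := sInf (ρ '' {x | ρ x ≠ 0})

/-- `δ_min(R) = sup_{ρ ∈ R} (-log min_{x ∈ supp ρ} ρ(x))`. -/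
def deltaMin (R : Set (X → ℝ)) : EReal :=
  ⨆ ρ ∈ R, ((-Real.log (minNonzeroProb ρ) : ℝ) : EReal)

end HypothesisTesting

end

/-!
Two one-sided bounds close a circle of inequalities
`sc_r(R‖σ) ≤ H_r^*(R‖σ) ≤ sup_ρ sc_r(ρ‖σ) ≤ sc_r(R‖σ)`, the last of which is plain monotonicity.

*Converse*, `H_r^*(ρ‖σ) ≤ sc_r(ρ‖σ)`: Hölder's inequality bounds the acceptance probability of every
test by `ρ^{⊗n}(T) ≤ e^{n ψ̃(u)} σ^{⊗n}(T)^u` (`acceptProb_le_rpow`, and `acceptProb_le_exp_mul` at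
`u = 1`).

*Achievability*, for a single state: for any distribution `q` supported in `supp ρ`, accepting the
`q`-typical sequences with probability `e^{-n (r - D(q‖σ))^+}` gives the exponent
`D(q‖ρ) + (r - D(q‖σ))^+` (`exists_test_of_relEntropyReal_lt`). This is the maximum of two functions
of `q`, one convex and the other affine. A two-function minimax principle, from Hahn–Banach in the
plane (`exists_lt_and_lt_of_forall_exists_combo_lt`), reduces minimizing the maximum to minimizing
each convex combination with weights `1 - u` and `u`; the tilted distributions do so with value
`u r - ψ̃(u)` (`exists_combo_le_sub_psiTilde`). If `supp ρ ⊄ supp σ`, the exponent `0` is attained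
by looking for a point that `σ` does not charge (`exists_test_of_not_suppLE`).

*Achievability*, for `R`: a lower bound on the nonzero probabilities makes `R` coverable by finitely
many of its members `τ` with `ρ ≥ e^{-ε} τ` (`exists_finite_net`). Since `ρ^{⊗n} ≥ e^{-nε} τ^{⊗n}`,
the average of the tests for these finitely many `τ` works for all of `R`, up to `ε` in the exponent.
-/

namespace HypothesisTesting

variable {X : Type*}

/-! ### Exponential rates and acceptance probabilities -/

theorem expRate_le_iff {n : ℕ} (hn : 0 < n) (p v : ℝ) :
    expRate n p ≤ (v : EReal) ↔ Real.exp (-(n * v)) ≤ p := by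
  have hn' : (0 : ℝ) < n := by exact_mod_cast hn
  unfold expRate
  rcases le_or_gt p 0 with hp | hp
  · have h0 : ¬ Real.exp (-(n * v)) ≤ p := not_le.mpr (hp.trans_lt (Real.exp_pos _))
    rw [ENNReal.ofReal_of_nonpos hp, ENNReal.log_zero,
      EReal.coe_mul_bot_of_pos (by positivity), EReal.neg_bot]
    simp [h0]
  · rw [ENNReal.log_ofReal_of_pos hp, ← EReal.coe_mul, ← EReal.coe_neg, EReal.coe_le_coe_iff,
      ← Real.le_log_iff_exp_le hp, one_div, neg_le, neg_le, ← div_eq_inv_mul, ← neg_div,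
      div_le_iff₀ hn', neg_le, mul_comm v]

theorem lt_expRate_iff {n : ℕ} (hn : 0 < n) (p v : ℝ) :
    (v : EReal) < expRate n p ↔ p < Real.exp (-(n * v)) := by
  rw [← not_le, expRate_le_iff hn, not_le]

theorem iidPow_nonneg {ρ : X → ℝ} (hρ : ∀ x, 0 ≤ ρ x) (n : ℕ) (x : Fin n → X) :
    0 ≤ iidPow ρ n x :=
  Finset.prod_nonneg fun _ _ => hρ _

theorem maxRelEntropy_eq_top {ρ σ : X → ℝ} (hρ : ∀ x, 0 ≤ ρ x) (hs : ¬ SuppLE ρ σ) :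
    maxRelEntropy ρ σ = ⊤ := by
  simp only [SuppLE, not_forall] at hs
  obtain ⟨x, hx, hx'⟩ := hs
  simp only [maxRelEntropy, iInf_eq_top]
  intro l hl
  have := hl x
  rw [hx, mul_zero] at this
  exact absurd (le_antisymm this (hρ x)) hx'

variable [Fintype X]

theorem sum_iidPow (ρ : X → ℝ) (n : ℕ) : ∑ x, iidPow ρ n x = (∑ x, ρ x) ^ n := by
  rw [Fintype.sum_pow]; rfl

theorem sum_iidPow_of_mem_stdSimplex {ρ : X → ℝ} (hρ : ρ ∈ stdSimplex ℝ X) (n : ℕ) :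
    ∑ x, iidPow ρ n x = 1 := by
  rw [sum_iidPow, hρ.2, one_pow]

theorem acceptProb_nonneg {ρ : X → ℝ} (hρ : ∀ x, 0 ≤ ρ x) {n : ℕ} {T : (Fin n → X) → ℝ}
    (hT : IsTest T) : 0 ≤ acceptProb ρ T :=
  Finset.sum_nonneg fun x _ => mul_nonneg (iidPow_nonneg hρ n x) (hT x).1

theorem acceptProb_le_one {ρ : X → ℝ} (hρ : ρ ∈ stdSimplex ℝ X) {n : ℕ} {T : (Fin n → X) → ℝ}
    (hT : IsTest T) : acceptProb ρ T ≤ 1 := by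
  rw [← sum_iidPow_of_mem_stdSimplex hρ n]
  exact Finset.sum_le_sum fun x _ => mul_le_of_le_one_right (iidPow_nonneg hρ.1 n x) (hT x).2

theorem acceptProb_compl {ρ : X → ℝ} (hρ : ρ ∈ stdSimplex ℝ X) {n : ℕ} (T : (Fin n → X) → ℝ) :
    acceptProb ρ (fun x => 1 - T x) = 1 - acceptProb ρ T := by
  simp only [acceptProb, mul_sub, mul_one, Finset.sum_sub_distrib,
    sum_iidPow_of_mem_stdSimplex hρ n]

theorem one_sub_typeIError_singleton {ρ : X → ℝ} (hρ : ρ ∈ stdSimplex ℝ X) {n : ℕ}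
    (T : (Fin n → X) → ℝ) : 1 - typeIError {ρ} T = acceptProb ρ T := by
  simp [typeIError, acceptProb_compl hρ]

theorem le_one_sub_typeIError {R : Set (X → ℝ)} (hR : R ⊆ stdSimplex ℝ X) (hne : R.Nonempty)
    {n : ℕ} {T : (Fin n → X) → ℝ} {c : ℝ} (h : ∀ ρ ∈ R, c ≤ acceptProb ρ T) :
    c ≤ 1 - typeIError R T := by
  have : typeIError R T ≤ 1 - c := by
    refine csSup_le (hne.image _) ?_
    rintro _ ⟨ρ, hρ, rfl⟩
    simp only [acceptProb_compl (hR hρ)]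
    linarith [h ρ hρ]
  linarith

theorem one_sub_typeIError_le {R : Set (X → ℝ)} (hR : R ⊆ stdSimplex ℝ X) {n : ℕ}
    {T : (Fin n → X) → ℝ} (hT : IsTest T) {ρ : X → ℝ} (hρ : ρ ∈ R) :
    1 - typeIError R T ≤ acceptProb ρ T := by
  have hb : BddAbove ((fun ρ => acceptProb ρ (fun x => 1 - T x)) '' R) := by
    refine ⟨1, ?_⟩
    rintro _ ⟨ρ', hρ', rfl⟩
    simp only [acceptProb_compl (hR hρ')]
    linarith [acceptProb_nonneg (hR hρ').1 hT]
  have := le_csSup hb ⟨ρ, hρ, rfl⟩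
  simp only [acceptProb_compl (hR hρ)] at this
  unfold typeIError
  linarith

theorem expRate_anti (n : ℕ) {p q : ℝ} (h : p ≤ q) : expRate n q ≤ expRate n p := by
  unfold expRate
  refine EReal.neg_le_neg_iff.mpr (mul_le_mul_of_nonneg_left ?_ ?_)
  · exact ENNReal.log_monotone (ENNReal.ofReal_le_ofReal h)
  · exact_mod_cast (by positivity : (0 : ℝ) ≤ 1 / (n : ℝ))

/-! ### The converse bound -/

theorem strongConverseExp_singleton_le {R : Set (X → ℝ)} (hR : R ⊆ stdSimplex ℝ X) (σ : X → ℝ)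
    (r : ℝ) {ρ : X → ℝ} (hρ : ρ ∈ R) :
    strongConverseExp {ρ} σ r ≤ strongConverseExp R σ r := by
  refine le_sInf ?_
  rintro _ ⟨T, hT, hr, rfl⟩
  refine le_trans (b := Filter.limsup (fun n => expRate n (1 - typeIError {ρ} (T n))) Filter.atTop)
    (sInf_le ⟨T, hT, hr, rfl⟩) ?_
  refine Filter.limsup_le_limsup (Filter.Eventually.of_forall fun n => expRate_anti n ?_)
  rw [one_sub_typeIError_singleton (hR hρ)]
  exact one_sub_typeIError_le hR (hT n) hρ

/-- A trade-off `ρ^{⊗n}(T) ≤ e^{nK} σ^{⊗n}(T)^u`, valid for all tests, bounds the strong converse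
exponent from below. -/
theorem sub_le_strongConverseExp {ρ σ : X → ℝ} (hρ : ρ ∈ stdSimplex ℝ X)
    (hσ : σ ∈ stdSimplex ℝ X) (r : ℝ) {u K : ℝ} (hu : 0 ≤ u)
    (h : ∀ (n : ℕ) (T : (Fin n → X) → ℝ), IsTest T →
      acceptProb ρ T ≤ Real.exp (n * K) * acceptProb σ T ^ u) :
    ((u * r - K : ℝ) : EReal) ≤ strongConverseExp {ρ} σ r := by
  refine le_sInf ?_
  rintro _ ⟨T, hT, hr, rfl⟩
  refine EReal.ge_of_forall_gt_iff_ge.mp fun z hz => ?_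
  have hz : z < u * r - K := by exact_mod_cast hz
  obtain ⟨s, hs, hzs⟩ : ∃ s < r, z < u * s - K := by
    have hc : Filter.Tendsto (fun s => u * s - K) (nhdsWithin r (Set.Iio r))
        (nhds (u * r - K)) :=
      ((continuous_const.mul continuous_id).sub continuous_const).continuousAt.mono_left
        nhdsWithin_le_nhds
    exact ((eventually_mem_nhdsWithin).and (hc.eventually_const_lt hz)).exists
  refine Filter.le_limsup_of_frequently_le (Filter.Eventually.frequently ?_)
  have hlt : (s : EReal) < Filter.liminf (fun n => expRate n (typeIIError σ (T n))) Filter.atTop :=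
    lt_of_lt_of_le (by exact_mod_cast hs) hr
  filter_upwards [Filter.eventually_lt_of_lt_liminf hlt, Filter.eventually_gt_atTop 0]
    with n hn hn0
  rw [lt_expRate_iff hn0] at hn
  rw [one_sub_typeIError_singleton hρ]
  refine ((lt_expRate_iff hn0 _ _).mpr ?_).le
  have hn' : (0 : ℝ) < n := by exact_mod_cast hn0
  calc acceptProb ρ (T n) ≤ Real.exp (n * K) * acceptProb σ (T n) ^ u := h n _ (hT n)
    _ ≤ Real.exp (n * K) * Real.exp (-(n * s)) ^ u := by
        gcongr
        · exact acceptProb_nonneg hσ.1 (hT n)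
        · exact hn.le
    _ = Real.exp (-(n * (u * s - K))) := by
        rw [← Real.exp_mul, ← Real.exp_add]; ring_nf
    _ < Real.exp (-(n * z)) := by gcongr

/-- Hölder's inequality with exponents `1/(1-u)` and `1/u`, applied to a test. -/
theorem acceptProb_le_rpow {ρ σ : X → ℝ} (hρ : ∀ x, 0 ≤ ρ x) (hσ : ∀ x, 0 ≤ σ x)
    (hs : SuppLE ρ σ) {u : ℝ} (hu0 : 0 < u) (hu1 : u < 1) {n : ℕ} {T : (Fin n → X) → ℝ}
    (hT : IsTest T) :
    acceptProb ρ T ≤ ((∑ x, ρ x ^ (1 - u)⁻¹ * σ x ^ (1 - (1 - u)⁻¹)) ^ n) ^ (1 - u)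
      * acceptProb σ T ^ u := by
  have h1u : 0 < 1 - u := by linarith
  set α := (1 - u)⁻¹ with hα
  have hα0 : 0 < α := inv_pos.mpr h1u
  have hpq : Real.HolderConjugate α u⁻¹ := by
    rw [Real.holderConjugate_iff]
    refine ⟨(one_lt_inv₀ h1u).mpr (by linarith), ?_⟩
    rw [hα, inv_inv, inv_inv]; ring
  have hpt : ∀ x, ρ x ^ α * σ x ^ (1 - α) = (ρ x * σ x ^ (-u)) ^ α := fun x => by
    rw [Real.mul_rpow (hρ x) (Real.rpow_nonneg (hσ x) _), ← Real.rpow_mul (hσ x)]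
    congr 2
    rw [hα]; field_simp; ring
  set f : (Fin n → X) → ℝ := fun x => iidPow (fun y => ρ y * σ y ^ (-u)) n x
  set g : (Fin n → X) → ℝ := fun x => (iidPow σ n x * T x) ^ u
  have hf0 : ∀ x, 0 ≤ f x := fun x =>
    iidPow_nonneg (fun y => mul_nonneg (hρ y) (Real.rpow_nonneg (hσ y) _)) n x
  have hg0 : ∀ x, 0 ≤ iidPow σ n x * T x := fun x =>
    mul_nonneg (iidPow_nonneg hσ n x) (hT x).1
  have hfg : ∀ x, iidPow ρ n x * T x ≤ f x * g x := fun x => by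
    have e : iidPow ρ n x = f x * iidPow σ n x ^ u := by
      simp only [f, iidPow]
      rw [← Real.finsetProd_rpow _ _ fun i _ => hσ _, ← Finset.prod_mul_distrib]
      refine Finset.prod_congr rfl fun i _ => ?_
      rcases (hσ (x i)).eq_or_lt with h | h
      · rw [hs _ h.symm]; simp
      · rw [mul_assoc, ← Real.rpow_add h]; simp
    rw [e]
    simp only [g]
    rw [Real.mul_rpow (iidPow_nonneg hσ n x) (hT x).1, mul_assoc]
    refine mul_le_mul_of_nonneg_left (mul_le_mul_of_nonneg_left ?_ ?_) (hf0 x)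
    · exact Real.self_le_rpow_of_le_one (hT x).1 (hT x).2 hu1.le
    · exact Real.rpow_nonneg (iidPow_nonneg hσ n x) _
  calc acceptProb ρ T ≤ ∑ x, f x * g x := Finset.sum_le_sum fun x _ => hfg x
    _ ≤ (∑ x, f x ^ α) ^ (1 / α) * (∑ x, g x ^ u⁻¹) ^ (1 / u⁻¹) :=
        Real.inner_le_Lp_mul_Lq_of_nonneg _ hpq (fun x _ => hf0 x)
          (fun x _ => Real.rpow_nonneg (hg0 x) _)
    _ = _ := by
        congr 1
        · rw [one_div, hα, inv_inv, ← hα, Fintype.sum_pow]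
          congr 1
          refine Finset.sum_congr rfl fun x _ => ?_
          simp only [f, iidPow]
          rw [← Real.finsetProd_rpow _ _
            fun i _ => mul_nonneg (hρ _) (Real.rpow_nonneg (hσ _) _)]
          exact Finset.prod_congr rfl fun i _ => (hpt _).symm
        · rw [one_div, inv_inv]
          congr 1
          refine Finset.sum_congr rfl fun x _ => ?_
          exact Real.rpow_rpow_inv (hg0 x) hu0.ne'

theorem sum_rpow_mul_rpow_pos {ρ σ : X → ℝ} (hρ : ρ ∈ stdSimplex ℝ X) (hσ : ∀ x, 0 ≤ σ x)
    (hs : SuppLE ρ σ) (α : ℝ) : 0 < ∑ x, ρ x ^ α * σ x ^ (1 - α) := by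
  obtain ⟨x, hx⟩ : ∃ x, ρ x ≠ 0 := by
    by_contra! h
    simpa [h] using hρ.2
  refine Finset.sum_pos' (fun y _ => mul_nonneg (Real.rpow_nonneg (hρ.1 y) _)
    (Real.rpow_nonneg (hσ y) _)) ⟨x, Finset.mem_univ _, ?_⟩
  exact mul_pos (Real.rpow_pos_of_pos ((hρ.1 x).lt_of_ne' hx) _)
    (Real.rpow_pos_of_pos ((hσ x).lt_of_ne' fun h => hx (hs x h)) _)

/-- The max-relative entropy is the maximal log-likelihood ratio, attained on the support. -/
theorem exists_maxRelEntropy_eq {ρ σ : X → ℝ} (hρ : ρ ∈ stdSimplex ℝ X) (hσ : ∀ x, 0 ≤ σ x)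
    (hs : SuppLE ρ σ) : ∃ x₀, ρ x₀ ≠ 0 ∧ maxRelEntropy ρ σ = (Real.log (ρ x₀ / σ x₀) : ℝ) ∧
      ∀ x, ρ x ≤ Real.exp (Real.log (ρ x₀ / σ x₀)) * σ x := by
  obtain ⟨x, hx⟩ : ∃ x, ρ x ≠ 0 := by
    by_contra! h
    simpa [h] using hρ.2
  have : Nonempty X := ⟨x⟩
  have hpos : ∀ y, ρ y ≠ 0 → 0 < ρ y / σ y := fun y hy =>
    div_pos ((hρ.1 y).lt_of_ne' hy) ((hσ y).lt_of_ne' fun h => hy (hs y h))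
  obtain ⟨x₀, hx₀⟩ := Finite.exists_max fun y => ρ y / σ y
  have h0 : 0 < ρ x₀ / σ x₀ := (hpos x hx).trans_le (hx₀ x)
  have hρ0 : ρ x₀ ≠ 0 := fun h => by simp [h] at h0
  have hσ0 : ∀ y, ρ y ≠ 0 → 0 < σ y := fun y hy => (hσ y).lt_of_ne' fun h => hy (hs y h)
  have hle : ∀ y, ρ y ≤ Real.exp (Real.log (ρ x₀ / σ x₀)) * σ y := fun y => by
    rw [Real.exp_log h0]
    rcases eq_or_ne (ρ y) 0 with hy | hy
    · rw [hy]; exact mul_nonneg h0.le (hσ y)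
    · exact (div_le_iff₀ (hσ0 y hy)).mp (hx₀ y)
  refine ⟨x₀, hρ0, le_antisymm (iInf₂_le _ hle) (le_iInf₂ fun l hl => ?_), hle⟩
  rw [EReal.coe_le_coe_iff, Real.log_le_iff_le_exp h0, div_le_iff₀ (hσ0 _ hρ0)]
  exact hl x₀

/-- The case `u = 1` of the trade-off between the two acceptance probabilities. -/
theorem acceptProb_le_exp_mul {ρ σ : X → ℝ} (hρ : ∀ x, 0 ≤ ρ x) {l : ℝ}
    (hl : ∀ x, ρ x ≤ Real.exp l * σ x) {n : ℕ} {T : (Fin n → X) → ℝ} (hT : IsTest T) :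
    acceptProb ρ T ≤ Real.exp (n * l) * acceptProb σ T := by
  unfold acceptProb
  rw [Finset.mul_sum]
  refine Finset.sum_le_sum fun x _ => ?_
  rw [← mul_assoc]
  refine mul_le_mul_of_nonneg_right ?_ (hT x).1
  calc iidPow ρ n x ≤ ∏ i, Real.exp l * σ (x i) :=
        Finset.prod_le_prod (fun i _ => hρ _) fun i _ => hl _
    _ = _ := by
        rw [Finset.prod_mul_distrib, Finset.prod_const, Finset.card_univ, Fintype.card_fin,
          ← Real.exp_nat_mul]
        rfl

theorem psiTilde_eq_top {ρ σ : X → ℝ} (hρ : ∀ x, 0 ≤ ρ x) (hs : ¬ SuppLE ρ σ) {u : ℝ}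
    (hu0 : u ≠ 0) (hu1 : u ≤ 1) : psiTilde ρ σ u = ⊤ := by
  unfold psiTilde
  rw [if_neg hu0]
  split_ifs with h1
  · exact maxRelEntropy_eq_top hρ hs
  · have : u < 1 := lt_of_le_of_ne hu1 h1
    rw [psi, if_neg hs, EReal.coe_mul_top_of_pos (by linarith)]

theorem hoeffdingAnti_le_strongConverseExp {ρ σ : X → ℝ} (hρ : ρ ∈ stdSimplex ℝ X)
    (hσ : σ ∈ stdSimplex ℝ X) (r : ℝ) :
    hoeffdingAnti ρ σ r ≤ strongConverseExp {ρ} σ r := by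
  refine iSup₂_le fun u hu => ?_
  rcases eq_or_ne u 0 with rfl | h0
  · have := sub_le_strongConverseExp hρ hσ r (u := 0) (K := 0) le_rfl
      fun n T hT => by simpa using acceptProb_le_one hρ hT
    simpa [psiTilde] using this
  by_cases hs : SuppLE ρ σ
  · unfold psiTilde
    rw [if_neg h0]
    split_ifs with h1
    · subst h1
      obtain ⟨x₀, -, he, hl⟩ := exists_maxRelEntropy_eq hρ hσ.1 hs
      rw [he, ← EReal.coe_sub]
      refine sub_le_strongConverseExp hρ hσ r hu.1 fun n T hT => ?_
      rw [Real.rpow_one]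
      exact acceptProb_le_exp_mul hρ.1 hl hT
    · have hu0 : 0 < u := hu.1.lt_of_ne' h0
      have hu1 : u < 1 := hu.2.lt_of_ne h1
      rw [psi, if_pos hs, ← EReal.coe_mul, ← EReal.coe_sub]
      refine sub_le_strongConverseExp hρ hσ r hu.1 fun n T hT => ?_
      refine (acceptProb_le_rpow hρ.1 hσ.1 hs hu0 hu1 hT).trans_eq ?_
      have hZ := sum_rpow_mul_rpow_pos hρ hσ.1 hs (1 - u)⁻¹
      congr 1
      rw [Real.rpow_def_of_pos (pow_pos hZ n), Real.log_pow]
      ring_nf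
  · rw [psiTilde_eq_top hρ.1 hs h0 hu.2, EReal.sub_top]
    exact bot_le

theorem hoeffdingAnti_nonneg (ρ σ : X → ℝ) (r : ℝ) : 0 ≤ hoeffdingAnti ρ σ r := by
  refine le_trans ?_ (le_iSup₂ (f := fun (u : ℝ) (_ : u ∈ Set.Icc (0 : ℝ) 1) =>
    (((u * r : ℝ) : EReal) - psiTilde ρ σ u)) 0 ⟨le_rfl, zero_le_one⟩)
  simp [psiTilde]

/-! ### A minimax principle -/

/-- Two convex functions on a convex set are simultaneously below `v` somewhere, as soon as each of
their convex combinations is below `v` somewhere. Otherwise a line in the plane separates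
`(v, v)` from the points lying above the joint range, and its normal vector is a bad weight. -/
theorem exists_lt_and_lt_of_forall_exists_combo_lt {E : Type*} [AddCommGroup E] [Module ℝ E]
    {Q : Set E} {f g : E → ℝ} (hf : ConvexOn ℝ Q f) (hg : ConvexOn ℝ Q g) {v : ℝ}
    (h : ∀ u ∈ Set.Icc (0 : ℝ) 1, ∃ q ∈ Q, (1 - u) * f q + u * g q < v) :
    ∃ q ∈ Q, f q < v ∧ g q < v := by
  by_contra! hcon
  let S : Set (ℝ × ℝ) := {p | ∃ q ∈ Q, f q < p.1 ∧ g q < p.2}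
  have hSo : IsOpen S := by
    have : S = ⋃ q ∈ Q, Set.Ioi (f q) ×ˢ Set.Ioi (g q) := by
      ext p
      simp only [S, Set.mem_ofPred_eq, Set.mem_iUnion, Set.mem_prod, Set.mem_Ioi, exists_prop]
    rw [this]
    exact isOpen_biUnion fun q _ => isOpen_Ioi.prod isOpen_Ioi
  have hSc : Convex ℝ S := by
    rintro p ⟨q, hq, h1, h2⟩ p' ⟨q', hq', h1', h2'⟩ a b ha hb hab
    have key : ∀ s s' t t' : ℝ, s < t → s' < t' → a * s + b * s' < a * t + b * t' := by
      intro s s' t t' hs ht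
      rcases ha.eq_or_lt with rfl | ha'
      · have : b = 1 := by linarith
        subst this; linarith
      · exact add_lt_add_of_lt_of_le (mul_lt_mul_of_pos_left hs ha')
          (mul_le_mul_of_nonneg_left ht.le hb)
    exact ⟨a • q + b • q', hf.1 hq hq' ha hb hab,
      (hf.2 hq hq' ha hb hab).trans_lt (key _ _ _ _ h1 h1'),
      (hg.2 hq hq' ha hb hab).trans_lt (key _ _ _ _ h2 h2')⟩
  have hv : (v, v) ∉ S := fun ⟨q, hq, h1, h2⟩ => (hcon q hq h1).not_gt h2
  obtain ⟨φ, hφ⟩ := geometric_hahn_banach_open_point hSc hSo hv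
  obtain ⟨s, hs⟩ : ∃ s, s = φ (1, 0) := ⟨_, rfl⟩
  obtain ⟨t, ht⟩ : ∃ t, t = φ (0, 1) := ⟨_, rfl⟩
  have hφ' : ∀ a b : ℝ, φ (a, b) = a * s + b * t := fun a b => by
    have : ((a, b) : ℝ × ℝ) = a • (1, 0) + b • (0, 1) := by simp
    rw [this, map_add, map_smul, map_smul, hs, ht]; rfl
  have hlt : ∀ q ∈ Q, ∀ a b : ℝ, 0 < a → 0 < b →
      (f q + a) * s + (g q + b) * t < v * s + v * t := fun q hq a b ha hb => by
    rw [← hφ', ← hφ']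
    exact hφ _ ⟨q, hq, by simpa using ha, by simpa using hb⟩
  obtain ⟨q₀, hq₀, -⟩ := h 0 ⟨le_rfl, zero_le_one⟩
  -- `S` is stable under increasing either coordinate, so both weights are nonpositive
  have hsle : s ≤ 0 := by
    by_contra! hs0
    have := hlt q₀ hq₀ (|v * s + v * t - f q₀ * s - (g q₀ + 1) * t| / s + 1) 1
      (by positivity) one_pos
    rw [← add_assoc, add_mul, add_mul, div_mul_cancel₀ _ hs0.ne'] at this
    linarith [le_abs_self (v * s + v * t - f q₀ * s - (g q₀ + 1) * t)]
  have htle : t ≤ 0 := by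
    by_contra! ht0
    have := hlt q₀ hq₀ 1 (|v * s + v * t - g q₀ * t - (f q₀ + 1) * s| / t + 1)
      one_pos (by positivity)
    rw [← add_assoc (g q₀), add_mul (g q₀ + _), add_mul (g q₀), div_mul_cancel₀ _ ht0.ne'] at this
    linarith [le_abs_self (v * s + v * t - g q₀ * t - (f q₀ + 1) * s)]
  have hst : s + t < 0 := by
    refine lt_of_le_of_ne (by linarith) fun h0 => ?_
    have hs0 : s = 0 := by linarith
    have ht0 : t = 0 := by linarith
    have := hlt q₀ hq₀ 1 1 one_pos one_pos
    simp [hs0, ht0] at this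
  obtain ⟨q, hq, hqv⟩ := h (t / (s + t))
    ⟨div_nonneg_of_nonpos htle hst.le, (div_le_one_of_neg hst).mpr (by linarith)⟩
  have e : 1 - t / (s + t) = s / (s + t) := by
    rw [eq_div_iff hst.ne, sub_mul, div_mul_cancel₀ _ hst.ne]; ring
  rw [e] at hqv
  set w := s / (s + t) * f q + t / (s + t) * g q with hw
  have hw' : w * (s + t) = f q * s + g q * t := by
    rw [hw, add_mul]; field_simp [hst.ne]
  have := hlt q hq (v - w) (v - w) (by linarith) (by linarith)
  linarith

/-! ### Attaining the Hoeffding anti-divergence -/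

/-- The real-valued relative entropy `∑ q (log q - log ρ)`; it is the relative entropy of `q` with
respect to `ρ` when `supp q ⊆ supp ρ`, and has no meaning otherwise since `Real.log 0 = 0`. -/
noncomputable def relEntropyReal (q ρ : X → ℝ) : ℝ := ∑ x, q x * (Real.log (q x) - Real.log (ρ x))

theorem convex_setOf_suppLE (ρ : X → ℝ) : Convex ℝ {q | q ∈ stdSimplex ℝ X ∧ SuppLE q ρ} := by
  rintro q ⟨hq, hqs⟩ q' ⟨hq', hqs'⟩ a b ha hb hab
  refine ⟨convex_stdSimplex ℝ X hq hq' ha hb hab, fun x hx => ?_⟩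
  simp [hqs x hx, hqs' x hx]

theorem convexOn_relEntropyReal (ρ : X → ℝ) :
    ConvexOn ℝ {q | q ∈ stdSimplex ℝ X ∧ SuppLE q ρ} fun q => relEntropyReal q ρ := by
  refine ⟨convex_setOf_suppLE ρ, fun q hq q' hq' a b ha hb hab => ?_⟩
  simp only [relEntropyReal, smul_eq_mul, Finset.mul_sum, ← Finset.sum_add_distrib]
  refine Finset.sum_le_sum fun x _ => ?_
  have := Real.convexOn_mul_log.2 (hq.1.1 x) (hq'.1.1 x) ha hb hab
  simp only [smul_eq_mul] at this
  simp only [Pi.add_apply, Pi.smul_apply, smul_eq_mul]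
  linarith

/-- The exponent of the type II error constraint is affine: the entropy of `q` cancels. -/
theorem convexOn_add_sub_relEntropyReal (ρ σ : X → ℝ) (r : ℝ) :
    ConvexOn ℝ {q | q ∈ stdSimplex ℝ X ∧ SuppLE q ρ}
      fun q => r + relEntropyReal q ρ - relEntropyReal q σ := by
  refine ⟨convex_setOf_suppLE ρ, fun q _ q' _ a b _ _ hab => le_of_eq ?_⟩
  have key : ∀ p : X → ℝ, r + relEntropyReal p ρ - relEntropyReal p σ
      = r + ∑ x, p x * (Real.log (σ x) - Real.log (ρ x)) := fun p => by
    rw [add_sub_assoc, relEntropyReal, relEntropyReal, ← Finset.sum_sub_distrib]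
    congr 1
    exact Finset.sum_congr rfl fun x _ => by ring
  simp only [key, Pi.add_apply, Pi.smul_apply, smul_eq_mul, add_mul, Finset.sum_add_distrib,
    mul_add, mul_assoc, ← Finset.mul_sum]
  linear_combination (-r) * hab

/-- For each weight `u`, the tilted distribution proportional to `ρ^{1/(1-u)} σ^{-u/(1-u)}` (at
`u = 1`, a point mass maximizing the likelihood ratio) attains the value `u r - ψ̃^*(ρ‖σ|u)`. -/
theorem exists_combo_le_sub_psiTilde {ρ σ : X → ℝ} (hρ : ρ ∈ stdSimplex ℝ X)
    (hσ : ∀ x, 0 ≤ σ x) (hs : SuppLE ρ σ) (r : ℝ) {u : ℝ} (hu : u ∈ Set.Icc (0 : ℝ) 1) :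
    ∃ q ∈ {q | q ∈ stdSimplex ℝ X ∧ SuppLE q ρ},
      (((1 - u) * relEntropyReal q ρ + u * (r + relEntropyReal q ρ - relEntropyReal q σ) : ℝ)
        : EReal) ≤ ((u * r : ℝ) : EReal) - psiTilde ρ σ u := by
  unfold psiTilde
  split_ifs with h0 h1
  · subst h0
    exact ⟨ρ, ⟨hρ, fun _ h => h⟩, by simp [relEntropyReal]⟩
  · subst h1
    obtain ⟨x₀, hx₀, he, -⟩ := exists_maxRelEntropy_eq hρ hσ hs
    classical
    refine ⟨Pi.single x₀ 1, ⟨single_mem_stdSimplex ℝ x₀, fun x hx => ?_⟩, ?_⟩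
    · rw [Pi.single_apply, if_neg]
      rintro rfl
      exact hx₀ hx
    · rw [he, ← EReal.coe_sub, EReal.coe_le_coe_iff, Real.log_div hx₀ fun h => hx₀ (hs _ h)]
      simp only [relEntropyReal, Pi.single_apply, ite_mul, one_mul, zero_mul, Finset.sum_ite_eq',
        Finset.mem_univ, if_true]
      simp only [Real.log_one]
      linarith
  · have hu1 : 0 < 1 - u := by linarith [hu.2.lt_of_ne h1]
    obtain ⟨α, hα⟩ : ∃ α, α = (1 - u)⁻¹ := ⟨_, rfl⟩
    have hα0 : 0 < α := hα ▸ inv_pos.mpr hu1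
    have hαu : (1 - u) * α = 1 := by rw [hα, mul_inv_cancel₀ hu1.ne']
    rw [psi, if_pos hs, ← EReal.coe_mul, ← EReal.coe_sub, ← hα]
    have hZ := sum_rpow_mul_rpow_pos hρ hσ hs α
    obtain ⟨Z, hZe⟩ : ∃ Z, Z = ∑ x, ρ x ^ α * σ x ^ (1 - α) := ⟨_, rfl⟩
    rw [← hZe] at hZ ⊢
    obtain ⟨q, hq⟩ : ∃ q : X → ℝ, q = fun x => ρ x ^ α * σ x ^ (1 - α) / Z := ⟨_, rfl⟩
    have hq1 : ∑ x, q x = 1 := by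
      rw [hq, ← Finset.sum_div, ← hZe, div_self hZ.ne']
    refine ⟨q, ⟨⟨fun x => ?_, hq1⟩, fun x hx => ?_⟩, ?_⟩
    · rw [hq]
      exact div_nonneg (mul_nonneg (Real.rpow_nonneg (hρ.1 x) _)
        (Real.rpow_nonneg (hσ x) _)) hZ.le
    · simp [hq, hx, Real.zero_rpow hα0.ne']
    · rw [EReal.coe_le_coe_iff]
      refine le_of_eq ?_
      have hpt : ∀ x, q x * ((1 - u) * (Real.log (q x) - Real.log (ρ x))
          + u * (Real.log (σ x) - Real.log (ρ x))) = q x * (-(1 - u) * Real.log Z) := fun x => by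
        rcases eq_or_ne (ρ x) 0 with hx | hx
        · simp [hq, hx, Real.zero_rpow hα0.ne']
        · have hρx := (hρ.1 x).lt_of_ne' hx
          have hσx := (hσ x).lt_of_ne' fun h => hx (hs x h)
          have hl : Real.log (q x)
              = α * Real.log (ρ x) + (1 - α) * Real.log (σ x) - Real.log Z := by
            rw [hq, Real.log_div (by positivity) hZ.ne', Real.log_mul (by positivity)
              (by positivity), Real.log_rpow hρx, Real.log_rpow hσx]
          rw [hl]
          linear_combination (q x) * (Real.log (ρ x) - Real.log (σ x)) * hαu
      have hsum := Finset.sum_congr (rfl : (Finset.univ : Finset X) = _) fun x _ => hpt x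
      rw [← Finset.sum_mul, hq1, one_mul] at hsum
      have : ∑ x, q x * ((1 - u) * (Real.log (q x) - Real.log (ρ x))
          + u * (Real.log (σ x) - Real.log (ρ x)))
          = (1 - u) * relEntropyReal q ρ + u * (relEntropyReal q ρ - relEntropyReal q σ) := by
        rw [relEntropyReal, relEntropyReal, ← Finset.sum_sub_distrib, Finset.mul_sum,
          Finset.mul_sum, ← Finset.sum_add_distrib]
        exact Finset.sum_congr rfl fun x _ => by ring
      linarith

theorem exists_relEntropyReal_lt {ρ σ : X → ℝ} (hρ : ρ ∈ stdSimplex ℝ X)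
    (hσ : ∀ x, 0 ≤ σ x) (hs : SuppLE ρ σ) {r v : ℝ} (hv : hoeffdingAnti ρ σ r < v) :
    ∃ q ∈ stdSimplex ℝ X, SuppLE q ρ ∧ relEntropyReal q ρ < v ∧
      r + relEntropyReal q ρ - relEntropyReal q σ < v := by
  obtain ⟨q, ⟨hq, hqs⟩, h⟩ := exists_lt_and_lt_of_forall_exists_combo_lt
    (convexOn_relEntropyReal ρ) (convexOn_add_sub_relEntropyReal ρ σ r) (v := v) fun u hu => by
      obtain ⟨q, hq, hle⟩ := exists_combo_le_sub_psiTilde hρ hσ hs r hu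
      refine ⟨q, hq, EReal.coe_lt_coe_iff.mp (hle.trans_lt (lt_of_le_of_lt ?_ hv))⟩
      exact le_iSup₂ (f := fun (u : ℝ) (_ : u ∈ Set.Icc (0 : ℝ) 1) =>
        (((u * r : ℝ) : EReal) - psiTilde ρ σ u)) u hu
  exact ⟨q, hq, hqs, h⟩

/-! ### Tests by change of measure -/

open Classical in
/-- A Chernoff bound: sums of independent copies of a function with negative mean are rarely
nonnegative. -/
theorem tendsto_sum_iidPow_nonneg {q h : X → ℝ} (hq : q ∈ stdSimplex ℝ X)
    (hh : ∑ x, q x * h x < 0) :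
    Filter.Tendsto (fun n : ℕ => ∑ x : Fin n → X, iidPow q n x * if 0 ≤ ∑ i, h (x i) then 1 else 0)
      Filter.atTop (nhds 0) := by
  -- the moment generating function equals `1` and has negative derivative at `0`
  obtain ⟨t, ht, hκ⟩ : ∃ t > 0, ∑ x, q x * Real.exp (t * h x) < 1 := by
    have hd : HasDerivAt (fun t => ∑ x, q x * Real.exp (t * h x)) (∑ x, q x * h x) 0 := by
      have := HasDerivAt.fun_sum (u := Finset.univ) fun x (_ : x ∈ Finset.univ) =>
        (((hasDerivAt_id (0 : ℝ)).mul_const (h x)).exp).const_mul (q x)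
      simpa using this
    have := hd.hasDerivWithinAt (s := Set.Ioi 0)
    rw [hasDerivWithinAt_iff_tendsto_slope' (by simp)] at this
    obtain ⟨t, hlt, ht⟩ := ((this.eventually_lt_const hh).and self_mem_nhdsWithin).exists
    refine ⟨t, ht, ?_⟩
    rw [slope_def_field, sub_zero, div_lt_iff₀ ht] at hlt
    simp only [zero_mul, Real.exp_zero, mul_one, hq.2] at hlt
    linarith
  refine squeeze_zero (fun n => Finset.sum_nonneg fun x _ => ?_) (fun n => ?_)
    (tendsto_pow_atTop_nhds_zero_of_lt_one
      (Finset.sum_nonneg fun x _ => mul_nonneg (hq.1 x) (Real.exp_pos _).le) hκ)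
  · exact mul_nonneg (iidPow_nonneg hq.1 n x) (by split_ifs <;> norm_num)
  · rw [Fintype.sum_pow]
    refine Finset.sum_le_sum fun x _ => ?_
    rw [Finset.prod_mul_distrib, ← Real.exp_sum, ← Finset.mul_sum]
    refine mul_le_mul_of_nonneg_left ?_ (iidPow_nonneg hq.1 n x)
    split_ifs with h0
    · exact Real.one_le_exp (mul_nonneg ht.le h0)
    · exact (Real.exp_pos _).le

/-- On sequences charged by `q`, the likelihood ratio is the exponential of a sum. -/
theorem iidPow_eq_mul_exp {Y : Type*} {q τ : Y → ℝ} (hq : ∀ x, 0 ≤ q x) (hτ : ∀ x, 0 ≤ τ x)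
    (hs : SuppLE q τ) (c : ℝ) {n : ℕ} {x : Fin n → Y}
    (hx : iidPow q n x ≠ 0) :
    iidPow τ n x = iidPow q n x *
      Real.exp (∑ i, (Real.log (τ (x i)) - Real.log (q (x i)) + c)) * Real.exp (-(n * c)) := by
  have hx' : ∀ i, q (x i) ≠ 0 := fun i => Finset.prod_ne_zero_iff.mp hx i (Finset.mem_univ i)
  rw [Finset.sum_add_distrib, Finset.sum_const, Finset.card_univ, Fintype.card_fin, nsmul_eq_mul,
    mul_assoc, ← Real.exp_add, add_neg_cancel_right, Real.exp_sum, iidPow, iidPow,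
    ← Finset.prod_mul_distrib]
  refine Finset.prod_congr rfl fun i _ => ?_
  have h1 := (hq (x i)).lt_of_ne' (hx' i)
  have h2 := (hτ (x i)).lt_of_ne' fun h => hx' i (hs _ h)
  rw [Real.exp_sub, Real.exp_log h1, Real.exp_log h2, mul_div_cancel₀ _ h1.ne']

/-- The test accepts the sequences whose log-likelihood ratios are typical for `q`, with a
probability `e^{-nc}` that makes up for a possible excess of `r` over the relative entropy of `q`
with respect to `σ`. -/
theorem exists_test_of_relEntropyReal_lt {ρ σ q : X → ℝ} (hρ : ∀ x, 0 ≤ ρ x) (hσ : ∀ x, 0 ≤ σ x)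
    (hs : SuppLE ρ σ) (hq : q ∈ stdSimplex ℝ X) (hqs : SuppLE q ρ) {r v : ℝ}
    (h1 : relEntropyReal q ρ < v) (h2 : r + relEntropyReal q ρ - relEntropyReal q σ < v) :
    ∀ᶠ n : ℕ in Filter.atTop, ∃ T : (Fin n → X) → ℝ, IsTest T ∧
      acceptProb σ T ≤ Real.exp (-(n * r)) ∧ Real.exp (-(n * v)) ≤ acceptProb ρ T := by
  classical
  have hqσ : SuppLE q σ := fun x hx => hqs x (hs x hx)
  -- `2 * ε` is the total loss of the two typicality thresholds, so `3 * ε` leaves a margin `ε`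
  obtain ⟨ε, hε, hε1, hε2⟩ : ∃ ε > 0, relEntropyReal q ρ + 3 * ε ≤ v ∧
      r + relEntropyReal q ρ - relEntropyReal q σ + 3 * ε ≤ v := by
    refine ⟨min (v - relEntropyReal q ρ)
      (v - (r + relEntropyReal q ρ - relEntropyReal q σ)) / 3,
      div_pos (lt_min (by linarith) (by linarith)) three_pos, ?_, ?_⟩
    · linarith [min_le_left (v - relEntropyReal q ρ)
        (v - (r + relEntropyReal q ρ - relEntropyReal q σ))]
    · linarith [min_le_right (v - relEntropyReal q ρ)
        (v - (r + relEntropyReal q ρ - relEntropyReal q σ))]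
  set a := relEntropyReal q ρ + ε with ha
  set b := relEntropyReal q σ - ε with hb
  set c := max (r - b) 0 with hc
  have hcv : a + c + ε ≤ v := by
    rcases max_cases (r - b) 0 with h | h <;> linarith
  set f : X → ℝ := fun x => Real.log (σ x) - Real.log (q x) + b with hf
  set g : X → ℝ := fun x => -(Real.log (ρ x) - Real.log (q x) + a) with hg
  have hfm : ∑ x, q x * f x < 0 := by
    have : ∑ x, q x * f x = -relEntropyReal q σ + b := by
      rw [relEntropyReal, ← Finset.sum_neg_distrib, ← mul_one b, ← hq.2, Finset.mul_sum,
        ← Finset.sum_add_distrib]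
      exact Finset.sum_congr rfl fun x _ => by rw [hf]; ring
    rw [this]; linarith
  have hgm : ∑ x, q x * g x < 0 := by
    have : ∑ x, q x * g x = relEntropyReal q ρ - a := by
      rw [relEntropyReal, ← mul_one a, ← hq.2, Finset.mul_sum, ← Finset.sum_sub_distrib]
      exact Finset.sum_congr rfl fun x _ => by rw [hg]; ring
    rw [this]; linarith
  have hexp : Filter.Tendsto (fun n : ℕ => Real.exp (-(n * ε))) Filter.atTop (nhds 0) :=
    Real.tendsto_exp_neg_atTop_nhds_zero.comp
      (tendsto_natCast_atTop_atTop.atTop_mul_const hε)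
  filter_upwards [(tendsto_sum_iidPow_nonneg hq hfm).eventually_lt_const
      (show (0 : ℝ) < 1 / 4 by norm_num),
    (tendsto_sum_iidPow_nonneg hq hgm).eventually_lt_const (show (0 : ℝ) < 1 / 4 by norm_num),
    hexp.eventually_lt_const (show (0 : ℝ) < 1 / 2 by norm_num)] with n hfn hgn hen
  let A : (Fin n → X) → Prop := fun x =>
    iidPow q n x ≠ 0 ∧ ∑ i, f (x i) < 0 ∧ ∑ i, g (x i) < 0
  have hA : 1 / 2 ≤ ∑ x, if A x then iidPow q n x else 0 := by
    have hpt : ∀ x, iidPow q n x ≤ (if A x then iidPow q n x else 0)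
        + (iidPow q n x * if 0 ≤ ∑ i, f (x i) then 1 else 0)
        + (iidPow q n x * if 0 ≤ ∑ i, g (x i) then 1 else 0) := fun x => by
      have h0 := iidPow_nonneg hq.1 n x
      rcases h0.eq_or_lt with h | h
      · simp [← h]
      by_cases hx1 : 0 ≤ ∑ i, f (x i) <;> by_cases hx2 : 0 ≤ ∑ i, g (x i) <;>
        simp only [hx1, hx2, if_true, if_false, mul_one, mul_zero] <;>
        split_ifs with hAx <;> first
          | linarith
          | exact absurd ⟨h.ne', not_le.mp hx1, not_le.mp hx2⟩ hAx
    have := Finset.sum_le_sum fun x (_ : x ∈ Finset.univ) => hpt x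
    rw [sum_iidPow_of_mem_stdSimplex hq, Finset.sum_add_distrib, Finset.sum_add_distrib] at this
    linarith
  have hA1 : (∑ x, if A x then iidPow q n x else 0) ≤ 1 := by
    rw [← sum_iidPow_of_mem_stdSimplex hq n]
    refine Finset.sum_le_sum fun x _ => ?_
    split_ifs
    exacts [le_rfl, iidPow_nonneg hq.1 n x]
  have hc0 : 0 ≤ (n : ℝ) * c := mul_nonneg n.cast_nonneg (le_max_right _ _)
  refine ⟨fun x => if A x then Real.exp (-(n * c)) else 0, fun x => ?_, ?_, ?_⟩
  · dsimp only
    split_ifs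
    · exact ⟨(Real.exp_pos _).le, Real.exp_le_one_iff.mpr (by linarith)⟩
    · exact ⟨le_rfl, zero_le_one⟩
  · have hpt : ∀ x, iidPow σ n x * (if A x then Real.exp (-(n * c)) else 0)
        ≤ Real.exp (-(n * r)) * if A x then iidPow q n x else 0 := fun x => by
      split_ifs with hx
      · rw [iidPow_eq_mul_exp hq.1 hσ hqσ b hx.1, mul_assoc, ← Real.exp_add, mul_assoc,
          ← Real.exp_add, mul_comm]
        refine mul_le_mul_of_nonneg_right (Real.exp_le_exp.mpr ?_) (iidPow_nonneg hq.1 n x)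
        have : (n : ℝ) * (r - b) ≤ n * c :=
          mul_le_mul_of_nonneg_left (le_max_left _ _) n.cast_nonneg
        have := hx.2.1
        simp only [hf] at this
        linarith
      · simp
    calc acceptProb σ _ ≤ _ := Finset.sum_le_sum fun x _ => hpt x
      _ ≤ Real.exp (-(n * r)) := by
        rw [← Finset.mul_sum]
        exact mul_le_of_le_one_right (Real.exp_pos _).le hA1
  · have hpt : ∀ x, Real.exp (-(n * (a + c))) * (if A x then iidPow q n x else 0)
        ≤ iidPow ρ n x * if A x then Real.exp (-(n * c)) else 0 := fun x => by
      split_ifs with hx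
      · rw [iidPow_eq_mul_exp hq.1 hρ hqs a hx.1, mul_assoc, ← Real.exp_add, mul_assoc,
          ← Real.exp_add, mul_comm]
        refine mul_le_mul_of_nonneg_left (Real.exp_le_exp.mpr ?_) (iidPow_nonneg hq.1 n x)
        have := hx.2.2
        simp only [hg, Finset.sum_neg_distrib] at this
        linarith
      · simp
    calc Real.exp (-(n * v)) ≤ Real.exp (-(n * (a + c))) * Real.exp (-(n * ε)) := by
          rw [← Real.exp_add]
          refine Real.exp_le_exp.mpr ?_
          have : (n : ℝ) * (a + c + ε) ≤ n * v := mul_le_mul_of_nonneg_left hcv n.cast_nonneg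
          linarith
      _ ≤ Real.exp (-(n * (a + c))) * ∑ x, if A x then iidPow q n x else 0 :=
          mul_le_mul_of_nonneg_left (by linarith) (Real.exp_pos _).le
      _ ≤ _ := by
          rw [Finset.mul_sum]
          exact Finset.sum_le_sum fun x _ => hpt x

/-- If `ρ` charges a point outside the support of `σ`, the test that looks for this point in the
first position has no type II error and accepts `ρ` with a fixed positive probability. -/
theorem exists_test_of_not_suppLE {ρ σ : X → ℝ} (hρ : ρ ∈ stdSimplex ℝ X)
    (hs : ¬ SuppLE ρ σ) {v : ℝ} (hv : 0 < v) (r : ℝ) :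
    ∀ᶠ n : ℕ in Filter.atTop, ∃ T : (Fin n → X) → ℝ, IsTest T ∧
      acceptProb σ T ≤ Real.exp (-(n * r)) ∧ Real.exp (-(n * v)) ≤ acceptProb ρ T := by
  classical
  simp only [SuppLE, not_forall] at hs
  obtain ⟨y, hy, hy'⟩ := hs
  have hexp : Filter.Tendsto (fun n : ℕ => Real.exp (-(n * v))) Filter.atTop (nhds 0) :=
    Real.tendsto_exp_neg_atTop_nhds_zero.comp
      (tendsto_natCast_atTop_atTop.atTop_mul_const hv)
  filter_upwards [hexp.eventually_lt_const ((hρ.1 y).lt_of_ne' hy'),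
    Filter.eventually_gt_atTop 0] with n hn hn0
  obtain ⟨m, rfl⟩ := Nat.exists_eq_add_one.mpr hn0
  have key : ∀ τ : X → ℝ, acceptProb τ (fun x : Fin (m + 1) → X => if x 0 = y then 1 else 0)
      = τ y * (∑ x, τ x) ^ m := fun τ => by
    rw [acceptProb, ← (Fin.consEquiv fun _ => X).sum_comp, Fintype.sum_prod_type]
    simp [iidPow, Fin.prod_univ_succ, Fin.consEquiv, Fintype.sum_pow, Finset.mul_sum]
  refine ⟨fun x => if x 0 = y then 1 else 0, fun x => ?_, ?_, ?_⟩
  · dsimp only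
    split_ifs <;> norm_num
  · rw [key, hy, zero_mul]
    exact (Real.exp_pos _).le
  · rw [key, hρ.2, one_pow, mul_one]
    exact hn.le

theorem exists_test_of_hoeffdingAnti_lt {ρ σ : X → ℝ} (hρ : ρ ∈ stdSimplex ℝ X)
    (hσ : ∀ x, 0 ≤ σ x) {r v : ℝ} (hv : hoeffdingAnti ρ σ r < v) :
    ∀ᶠ n : ℕ in Filter.atTop, ∃ T : (Fin n → X) → ℝ, IsTest T ∧
      acceptProb σ T ≤ Real.exp (-(n * r)) ∧ Real.exp (-(n * v)) ≤ acceptProb ρ T := by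
  by_cases hs : SuppLE ρ σ
  · obtain ⟨q, hq, hqs, h1, h2⟩ := exists_relEntropyReal_lt hρ hσ hs hv
    exact exists_test_of_relEntropyReal_lt hρ.1 hσ hs hq hqs h1 h2
  · exact exists_test_of_not_suppLE hρ hs
      (by exact_mod_cast (hoeffdingAnti_nonneg ρ σ r).trans_lt hv) r

/-! ### Reduction of the composite problem to finitely many states -/

theorem exists_forall_le_of_deltaMin_lt_top {R : Set (X → ℝ)} (hR : R ⊆ stdSimplex ℝ X)
    (hδ : deltaMin R < ⊤) : ∃ m > 0, ∀ ρ ∈ R, ∀ x, ρ x ≠ 0 → m ≤ ρ x := by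
  obtain ⟨d, hd⟩ := EReal.lt_iff_exists_real_btwn.mp hδ
  refine ⟨Real.exp (-d), Real.exp_pos _, fun ρ hρ x hx => ?_⟩
  have h1 : -Real.log (minNonzeroProb ρ) ≤ d := by
    have := (le_iSup₂ (f := fun (ρ : X → ℝ) (_ : ρ ∈ R) =>
      ((-Real.log (minNonzeroProb ρ) : ℝ) : EReal)) ρ hρ).trans hd.1.le
    exact_mod_cast this
  have hfin : (ρ '' {x | ρ x ≠ 0}).Finite := Set.toFinite _
  have hmem : minNonzeroProb ρ ∈ ρ '' {x | ρ x ≠ 0} :=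
    Set.Nonempty.csInf_mem ⟨_, x, hx, rfl⟩ hfin
  have hpos : 0 < minNonzeroProb ρ := by
    obtain ⟨y, hy, he⟩ := hmem
    rw [← he]
    exact ((hR hρ).1 y).lt_of_ne' hy
  calc Real.exp (-d) ≤ minNonzeroProb ρ := by
        rw [← Real.le_log_iff_exp_le hpos]; linarith
    _ ≤ ρ x := csInf_le hfin.bddBelow ⟨x, hx, rfl⟩

/-- When the nonzero probabilities are bounded away from zero, an additive net in `R` of small
enough mesh is a multiplicative one. -/
theorem exists_finite_net {R : Set (X → ℝ)} (hR : R ⊆ stdSimplex ℝ X) {m : ℝ} (hm : 0 < m)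
    (hRm : ∀ ρ ∈ R, ∀ x, ρ x ≠ 0 → m ≤ ρ x) {ε : ℝ} (hε : 0 < ε) :
    ∃ F : Finset (X → ℝ), ↑F ⊆ R ∧
      ∀ ρ ∈ R, ∃ τ ∈ F, ∀ x, Real.exp (-ε) * τ x ≤ ρ x := by
  have hb : TotallyBounded R := (isCompact_stdSimplex ℝ X).totallyBounded.subset hR
  have hε' : Real.exp (-ε) < 1 := Real.exp_lt_one_iff.mpr (by linarith)
  obtain ⟨t, htR, htf, ht⟩ := Metric.finite_approx_of_totallyBounded hb
    (m * (1 - Real.exp (-ε))) (mul_pos hm (by linarith))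
  refine ⟨htf.toFinset, by simpa using htR, fun ρ hρ => ?_⟩
  obtain ⟨τ, hτ, hd⟩ := Set.mem_iUnion₂.mp (ht hρ)
  refine ⟨τ, by simpa using hτ, fun x => ?_⟩
  rcases eq_or_ne (τ x) 0 with hx | hx
  · rw [hx, mul_zero]
    exact (hR hρ).1 x
  · have h1 : |ρ x - τ x| < m * (1 - Real.exp (-ε)) := by
      rw [← Real.dist_eq]
      exact (dist_le_pi_dist ρ τ x).trans_lt (Metric.mem_ball.mp hd)
    have h2 : m * (1 - Real.exp (-ε)) ≤ τ x * (1 - Real.exp (-ε)) :=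
      mul_le_mul_of_nonneg_right (hRm τ (htR hτ) x hx) (by linarith)
    linarith [neg_abs_le (ρ x - τ x)]

/-- The average of the tests for the members of a finite net serves all of `R`: the multiplicative
closeness costs an arbitrarily small exponent, and the number of tests is constant. -/
theorem strongConverseExp_le_hoeffdingAntiSet {R : Set (X → ℝ)} (hR : R ⊆ stdSimplex ℝ X)
    (hne : R.Nonempty) {σ : X → ℝ} (hσ : ∀ x, 0 ≤ σ x) (hδ : deltaMin R < ⊤) (r : ℝ) :
    strongConverseExp R σ r ≤ hoeffdingAntiSet R σ r := by
  classical
  obtain ⟨m, hm, hRm⟩ := exists_forall_le_of_deltaMin_lt_top hR hδ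
  refine EReal.le_of_forall_lt_iff_le.mp fun z hz => ?_
  obtain ⟨v, hv, hvz⟩ := EReal.lt_iff_exists_real_btwn.mp hz
  have hvz : v < z := by exact_mod_cast hvz
  obtain ⟨ε, hε, hεz⟩ : ∃ ε > 0, v + 2 * ε = z := ⟨(z - v) / 2, by linarith, by ring⟩
  obtain ⟨F, hFR, hF⟩ := exists_finite_net hR hm hRm hε
  have hF0 : F.Nonempty := by
    obtain ⟨ρ, hρ⟩ := hne
    obtain ⟨τ, hτ, -⟩ := hF ρ hρ
    exact ⟨τ, hτ⟩
  have hN : (0 : ℝ) < F.card := by exact_mod_cast hF0.card_pos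
  have hexp : Filter.Tendsto (fun n : ℕ => Real.exp (-(n * ε))) Filter.atTop (nhds 0) :=
    Real.tendsto_exp_neg_atTop_nhds_zero.comp
      (tendsto_natCast_atTop_atTop.atTop_mul_const hε)
  have hτ : ∀ τ ∈ F, ∀ᶠ n : ℕ in Filter.atTop, ∃ T : (Fin n → X) → ℝ, IsTest T ∧
      acceptProb σ T ≤ Real.exp (-(n * r)) ∧ Real.exp (-(n * v)) ≤ acceptProb τ T :=
    fun τ hτ => exists_test_of_hoeffdingAnti_lt (hR (hFR hτ)) hσ
      ((le_iSup₂ (f := fun (ρ : X → ℝ) (_ : ρ ∈ R) => hoeffdingAnti ρ σ r) τ (hFR hτ)).trans_lt hv)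
  have key : ∀ᶠ n : ℕ in Filter.atTop, ∃ T : (Fin n → X) → ℝ, IsTest T ∧
      acceptProb σ T ≤ Real.exp (-(n * r)) ∧
      ∀ ρ ∈ R, Real.exp (-(n * z)) ≤ acceptProb ρ T := by
    filter_upwards [(Filter.eventually_all_finset F).mpr hτ,
      hexp.eventually_lt_const (inv_pos.mpr hN)] with n hn hen
    choose! S hS hSσ hSτ using hn
    have hacc : ∀ τ : X → ℝ, acceptProb τ (fun x => (F.card : ℝ)⁻¹ * ∑ i ∈ F, S i x)
        = (F.card : ℝ)⁻¹ * ∑ i ∈ F, acceptProb τ (S i) := fun τ => by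
      simp only [acceptProb]
      rw [Finset.sum_comm, Finset.mul_sum]
      refine Finset.sum_congr rfl fun x _ => ?_
      rw [← Finset.mul_sum]; ring
    have hmean : ∀ (f : (X → ℝ) → ℝ) (c : ℝ), (∀ i ∈ F, f i ≤ c) →
        (F.card : ℝ)⁻¹ * ∑ i ∈ F, f i ≤ c := fun f c hf => by
      rw [inv_mul_le_iff₀ hN, ← nsmul_eq_mul]
      exact Finset.sum_le_card_nsmul F f c hf
    refine ⟨fun x => (F.card : ℝ)⁻¹ * ∑ i ∈ F, S i x, fun x => ⟨?_, ?_⟩, ?_, fun ρ hρ => ?_⟩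
    · exact mul_nonneg (inv_nonneg.mpr hN.le) (Finset.sum_nonneg fun i hi => (hS i hi x).1)
    · exact hmean _ _ fun i hi => (hS i hi x).2
    · rw [hacc]
      exact hmean _ _ hSσ
    · obtain ⟨τ, hτF, hle⟩ := hF ρ hρ
      have hτ0 : ∀ x, 0 ≤ τ x := (hR (hFR hτF)).1
      have hcomp : Real.exp (-(n * ε)) * acceptProb τ (S τ) ≤ acceptProb ρ (S τ) := by
        unfold acceptProb
        rw [Finset.mul_sum]
        refine Finset.sum_le_sum fun x _ => ?_
        rw [← mul_assoc]
        refine mul_le_mul_of_nonneg_right ?_ (hS τ hτF x).1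
        calc Real.exp (-(n * ε)) * iidPow τ n x = ∏ i, Real.exp (-ε) * τ (x i) := by
              rw [Finset.prod_mul_distrib, Finset.prod_const, Finset.card_univ, Fintype.card_fin,
                ← Real.exp_nat_mul, mul_neg]
              rfl
          _ ≤ iidPow ρ n x := Finset.prod_le_prod
              (fun i _ => mul_nonneg (Real.exp_pos _).le (hτ0 _)) fun i _ => hle _
      rw [hacc]
      calc Real.exp (-(n * z))
          = Real.exp (-(n * ε)) * (Real.exp (-(n * ε)) * Real.exp (-(n * v))) := by
            rw [← Real.exp_add, ← Real.exp_add, ← hεz]; ring_nf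
        _ ≤ (F.card : ℝ)⁻¹ * (Real.exp (-(n * ε)) * acceptProb τ (S τ)) := by
            gcongr
            exact hSτ τ hτF
        _ ≤ (F.card : ℝ)⁻¹ * ∑ i ∈ F, acceptProb ρ (S i) := by
            refine mul_le_mul_of_nonneg_left (hcomp.trans ?_) (inv_nonneg.mpr hN.le)
            exact Finset.single_le_sum (f := fun i => acceptProb ρ (S i))
              (fun i hi => acceptProb_nonneg (hR hρ).1 (hS i hi)) hτF
  obtain ⟨n₀, hn₀⟩ := Filter.eventually_atTop.mp key
  choose! T hT hTσ hTR using hn₀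
  let T' : (n : ℕ) → (Fin n → X) → ℝ := fun n => if n₀ ≤ n then T n else 0
  have hT'n : ∀ n, n₀ ≤ n → T' n = T n := fun n hn => if_pos hn
  have hT' : ∀ n, IsTest (T' n) := fun n => by
    by_cases hn : n₀ ≤ n
    · rw [hT'n n hn]
      exact hT n hn
    · simp [T', hn, IsTest]
  refine le_trans (b := Filter.limsup (fun n => expRate n (1 - typeIError R (T' n))) Filter.atTop)
    (sInf_le ⟨T', hT', ?_, rfl⟩) ?_
  · refine EReal.ge_of_forall_gt_iff_ge.mp fun s hs => ?_
    have hs : s < r := by exact_mod_cast hs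
    refine Filter.le_liminf_of_le (h := ?_)
    filter_upwards [Filter.eventually_ge_atTop n₀, Filter.eventually_gt_atTop 0] with n hn hn0
    refine ((lt_expRate_iff hn0 _ _).mpr ?_).le
    rw [hT'n n hn]
    refine (hTσ n hn).trans_lt (Real.exp_lt_exp.mpr ?_)
    have hn' : (0 : ℝ) < n := by exact_mod_cast hn0
    exact neg_lt_neg (mul_lt_mul_of_pos_left hs hn')
  · refine Filter.limsup_le_of_le (h := ?_)
    filter_upwards [Filter.eventually_ge_atTop n₀, Filter.eventually_gt_atTop 0] with n hn hn0
    rw [expRate_le_iff hn0, hT'n n hn]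
    exact le_one_sub_typeIError hR hne (hTR n hn)

end HypothesisTesting

theorem mainTheorem1 {X : Type*} [Fintype X] (R : Set (X → ℝ)) (hR : R ⊆ stdSimplex ℝ X)
    (σ : X → ℝ) (hσ : σ ∈ stdSimplex ℝ X)
    (hδ : HypothesisTesting.deltaMin R < ⊤)
    (r : ℝ)
    (hr : HypothesisTesting.relEntropySet R σ < (r : EReal))
    (hr' : (r : EReal) < ⨅ ρ ∈ R, HypothesisTesting.rInfty ρ σ) :
    HypothesisTesting.strongConverseExp R σ r = HypothesisTesting.hoeffdingAntiSet R σ r ∧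
    HypothesisTesting.hoeffdingAntiSet R σ r
      = ⨆ ρ ∈ R, HypothesisTesting.strongConverseExp {ρ} σ r := by
  have hne : R.Nonempty := by
    by_contra! h
    simp [HypothesisTesting.relEntropySet, h] at hr
  have h1 := HypothesisTesting.strongConverseExp_le_hoeffdingAntiSet hR hne hσ.1 hδ r
  have h2 : HypothesisTesting.hoeffdingAntiSet R σ r
      ≤ ⨆ ρ ∈ R, HypothesisTesting.strongConverseExp {ρ} σ r :=
    iSup₂_mono fun ρ hρ => HypothesisTesting.hoeffdingAnti_le_strongConverseExp (hR hρ) hσ r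
  have h3 : ⨆ ρ ∈ R, HypothesisTesting.strongConverseExp {ρ} σ r
      ≤ HypothesisTesting.strongConverseExp R σ r :=
    iSup₂_le fun ρ hρ => HypothesisTesting.strongConverseExp_singleton_le hR σ r hρ
  exact ⟨le_antisymm h1 (h2.trans h3), le_antisymm h2 (h3.trans h1)⟩
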